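/- For two groups $G(\circ)$ and $G(\ast)$ defined on the same finite set $G$, let $\mathrm{dist}(G(\circ),G(\ast))$ be the number of pairs $(a,b)\in G\times G$ with $a\circ b\neq a\ast b$. The Cayley stability of $G(\circ)$ is $$\delta(G(\circ))=\min\{\mathrm{dist}(G(\circ),G(\ast)) : G(\ast)\text{ is a group on the set } G,\ G(\ast)\neq G(\circ)\}.$$ If $G(\circ)$ is a group of prime order $p>31$, then $\delta(G(\circ))=6p-18$. -/

import Mathlib

/-- The Hamming distance of two group structures `A`, `B` on the same finite set `G`: the number
of pairs `(a, b)` at which the two multiplications differ. -/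
noncomputable def groupDist {G : Type*} [Finite G] (A B : Group G) : ℕ :=
  {ab : G × G | A.mul ab.1 ab.2 ≠ B.mul ab.1 ab.2}.ncard

/-- The distances from the group `A` to all the other groups defined on the same finite set `G`.
(Two terms of `Group G` are equal exactly when their multiplications are, by `Group.ext`.) -/
def distancesToOthers {G : Type*} [Finite G] (A : Group G) : Set ℕ :=
  {d | ∃ B : Group G, B ≠ A ∧ groupDist A B = d}

/-- The Cayley stability of the group `A`: the least distance from `A` to another group on the
same set. The infimum of a nonempty set of natural numbers is its minimum; the value is `0` only
when there is no other group on `G`, as two distinct groups have positive distance. -/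
noncomputable def cayleyStability {G : Type*} [Finite G] (A : Group G) : ℕ :=
  sInf (distancesToOthers A)

/-! Both groups are copies of `ZMod p`, so their distance is the additivity defect of the transition
permutation `f`. A defect below `6 * p - 18` is under two ninths of all pairs, so linearity testing
yields a homomorphism agreeing with `f` at over two thirds of the points. It is invertible, and
dividing by it preserves the defect and leaves a permutation `e ≠ 1` moving `m < p / 3` points.

Additivity of `e` fails whenever exactly one of `a`, `b`, `a + b` is moved, which gives at least `3
* m * (p - 2 * m)` failures. This suffices for `m ≥ 3`. For `m = 2` it gives `6 * p - 24`, and six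
exceptional pairs supply the rest. The transposition of `1` and `-1` attains the bound. -/

/-- The pairs at which a map between additive groups fails to be additive. -/
def additivityDefect {G H : Type*} [AddCommGroup G] [AddCommGroup H] [Fintype G] [DecidableEq H]
    (f : G → H) : Finset (G × G) :=
  Finset.univ.filter fun x => f (x.1 + x.2) ≠ f x.1 + f x.2

/-! ### Linearity testing -/

/-- A map that rarely separates two points is nearly constant. -/
theorem exists_majority_value {G H : Type*} [Fintype G] [DecidableEq H] (h : G → H)
    (hh : 9 * (Finset.univ.filter fun x : G × G => h x.1 ≠ h x.2).card < 4 * Fintype.card G ^ 2) :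
    ∃ v, 3 * (Finset.univ.filter fun y => h y ≠ v).card < Fintype.card G := by
  classical
  have hN : 0 < Fintype.card G := by
    by_contra hc
    have : Fintype.card G = 0 := by omega
    simp [this] at hh
  have : Nonempty G := Fintype.card_pos_iff.1 hN
  obtain ⟨y₀, hy₀⟩ := Finite.exists_min
    fun y => (Finset.univ.filter fun z => h z ≠ h y).card
  refine ⟨h y₀, ?_⟩
  set N := Fintype.card G with hNdef
  set S := Finset.univ.filter fun z => h z ≠ h y₀ with hS
  set T := Finset.univ.filter fun x : G × G => h x.1 ≠ h x.2 with hT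
  -- With `s = |S| / N`, `h2` gives `s * (1 - s) < 2 / 9`, so `s < 1 / 3` or `s > 2 / 3`; the
  -- minimality of `S` gives `s < 4 / 9`, which excludes the latter.
  have h1 : N * S.card ≤ T.card := by
    have hTs : T.card = ∑ y : G, (Finset.univ.filter fun z => h z ≠ h y).card := by
      simp only [hT, Finset.card_filter, Fintype.sum_prod_type]
      exact Finset.sum_comm
    rw [hTs]
    calc N * S.card = ∑ _y : G, S.card := by simp [hNdef]
      _ ≤ _ := Finset.sum_le_sum fun y _ => hy₀ y
  have h2 : 2 * (S.card * Sᶜ.card) ≤ T.card := by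
    have hd : Disjoint (S ×ˢ Sᶜ) (Sᶜ ×ˢ S) := by
      rw [Finset.disjoint_left]
      rintro ⟨a, b⟩ hab hba
      simp only [Finset.mem_product, Finset.mem_compl] at hab hba
      exact hba.1 hab.1
    calc 2 * (S.card * Sᶜ.card) = (S ×ˢ Sᶜ ∪ Sᶜ ×ˢ S).card := by
          rw [Finset.card_union_of_disjoint hd, Finset.card_product, Finset.card_product]; ring
      _ ≤ T.card := by
          refine Finset.card_le_card ?_
          rintro ⟨a, b⟩ hab
          simp only [Finset.mem_union, Finset.mem_product, Finset.mem_compl, hS, hT,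
            Finset.mem_filter, Finset.mem_univ, true_and, not_not] at hab ⊢
          grind
  have h3 : S.card + Sᶜ.card = N := Finset.card_add_card_compl S
  have h4 : 9 * S.card < 4 * N := by nlinarith
  by_contra hc
  push Not at hc
  nlinarith

/-- **Linearity testing**: a map between finite abelian groups that is additive at more than seven
ninths of all pairs agrees with a homomorphism at more than two thirds of all points. -/
theorem exists_addMonoidHom_of_card_additivityDefect_lt {G H : Type*} [AddCommGroup G]
    [AddCommGroup H] [Fintype G] [DecidableEq H] (f : G → H)
    (hf : 9 * (additivityDefect f).card < 2 * Fintype.card G ^ 2) :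
    ∃ g : G →+ H, 3 * (Finset.univ.filter fun x => f x ≠ g x).card < Fintype.card G := by
  classical
  have key : ∀ x, ∃ v, 3 * (Finset.univ.filter fun y => f (x + y) - f y ≠ v).card
      < Fintype.card G := by
    intro x
    apply exists_majority_value
    -- Expand `f (x + a + b)` as `f (x + a) + f b` and as `f (x + b) + f a`: if both are valid, the
    -- two differences agree.
    have hsub : (Finset.univ.filter fun y : G × G => f (x + y.1) - f y.1 ≠ f (x + y.2) - f y.2) ⊆
        (additivityDefect f).preimage (fun y : G × G => (x + y.1, y.2))
          (by rintro ⟨a, b⟩ _ ⟨c, d⟩ _ h; simpa using h) ∪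
        (additivityDefect f).preimage (fun y : G × G => (x + y.2, y.1))
          (by rintro ⟨a, b⟩ _ ⟨c, d⟩ _ h; simpa [and_comm] using h) := by
      rintro ⟨a, b⟩ hab
      simp only [Finset.mem_union, Finset.mem_preimage, additivityDefect, Finset.mem_filter,
        Finset.mem_univ, true_and] at hab ⊢
      by_contra! hc
      apply hab
      rw [sub_eq_sub_iff_add_eq_add, ← hc.1, ← hc.2]
      congr 1
      abel
    have h1 := (Finset.card_le_card hsub).trans (Finset.card_union_le _ _)
    have h2 : ∀ (φ : G × G → G × G) (hφ : Set.InjOn φ (φ ⁻¹' (additivityDefect f : Set (G × G)))),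
        ((additivityDefect f).preimage φ hφ).card ≤ (additivityDefect f).card := fun φ hφ =>
      Finset.card_le_card_of_injOn φ (fun a ha => Finset.mem_preimage.1 ha)
        (fun a ha b hb h => hφ (by simpa using ha) (by simpa using hb) h)
    have h3 := h1.trans (add_le_add (h2 _ _) (h2 _ _))
    omega
  choose g hg using key
  have hadd : ∀ x y, g (x + y) = g x + g y := by
    intro x y
    have hx : (Finset.univ.filter fun z => f (x + (y + z)) - f (y + z) ≠ g x).card ≤
        (Finset.univ.filter fun z => f (x + z) - f z ≠ g x).card :=
      Finset.card_le_card_of_injOn (fun z => y + z) (fun z hz => by simpa using hz)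
        (fun a _ b _ h => add_left_cancel h)
    have hgx := hg x
    have hgy := hg y
    have hgxy := hg (x + y)
    by_contra hne
    -- Three sets, each smaller than a third of `G`, cannot cover it; a point `z` outside them would
    -- give additivity.
    have hcov : (Finset.univ : Finset G) ⊆
        (Finset.univ.filter fun z => f (x + (y + z)) - f (y + z) ≠ g x) ∪
        (Finset.univ.filter fun z => f (y + z) - f z ≠ g y) ∪
        (Finset.univ.filter fun z => f (x + y + z) - f z ≠ g (x + y)) := by
      intro z _
      simp only [Finset.mem_union, Finset.mem_filter, Finset.mem_univ, true_and]
      by_contra! hc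
      apply hne
      rw [← hc.1.1, ← hc.1.2, ← hc.2, add_assoc]
      abel
    have hcard := (Finset.card_le_card hcov).trans ((Finset.card_union_le _ _).trans
      (Nat.add_le_add_right (Finset.card_union_le _ _) _))
    rw [Finset.card_univ] at hcard
    omega
  refine ⟨AddMonoidHom.mk' g hadd, ?_⟩
  simp only [AddMonoidHom.mk'_apply]
  set D := Finset.univ.filter fun x => f x ≠ g x with hD
  have hrow : ∀ x ∈ D, 2 * Fintype.card G ≤
      3 * (Finset.univ.filter fun y => f (x + y) ≠ f x + f y).card := by
    intro x hx
    have hcov : (Finset.univ : Finset G) ⊆ (Finset.univ.filter fun y => f (x + y) ≠ f x + f y) ∪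
        (Finset.univ.filter fun y => f (x + y) - f y ≠ g x) := by
      intro y _
      simp only [Finset.mem_union, Finset.mem_filter, Finset.mem_univ, true_and]
      by_contra! hc
      refine (Finset.mem_filter.1 hx).2 ?_
      rw [← hc.2, hc.1, add_sub_cancel_right]
    have := (Finset.card_le_card hcov).trans (Finset.card_union_le _ _)
    rw [Finset.card_univ] at this
    have := hg x
    omega
  have hsum : (additivityDefect f).card =
      ∑ x, (Finset.univ.filter fun y => f (x + y) ≠ f x + f y).card := by
    simp only [additivityDefect, Finset.card_filter, Fintype.sum_prod_type]
  have hle : D.card * (2 * Fintype.card G) ≤ 3 * (additivityDefect f).card := by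
    rw [hsum, Finset.mul_sum]
    calc D.card * (2 * Fintype.card G) = ∑ _x ∈ D, 2 * Fintype.card G := by simp
      _ ≤ ∑ x ∈ D, 3 * (Finset.univ.filter fun y => f (x + y) ≠ f x + f y).card :=
        Finset.sum_le_sum hrow
      _ ≤ _ := Finset.sum_le_sum_of_subset (Finset.subset_univ D)
  have hN : 0 < Fintype.card G := Fintype.card_pos
  nlinarith

/-! ### Transpositions and pointwise bounds -/

theorem swap_card_identity {G : Type*} [Fintype G] [DecidableEq G] {u v : G} (huv : u ≠ v) :
    (6 * Fintype.card G - 18 : ℤ) =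
      3 * ({u, v} : Finset G).card * (Fintype.card G - 2 * ({u, v} : Finset G).card) +
      (({u, v} : Finset G).card + 2 * (({u, v} : Finset G).card *
        (({u, v} : Finset G).card - 1))) := by
  rw [Finset.card_pair huv]; push_cast; ring

theorem swap_apply_of_mem_pair {G : Type*} [AddCommGroup G] [DecidableEq G] {u v x : G}
    (hx : x ∈ ({u, v} : Finset G)) :
    Equiv.swap u v x = u + v - x := by
  rw [Finset.mem_insert, Finset.mem_singleton] at hx
  rcases hx with rfl | rfl <;> simp

theorem swap_apply_of_notMem_pair {G : Type*} [DecidableEq G] {u v x : G}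
    (hx : x ∉ ({u, v} : Finset G)) :
    Equiv.swap u v x = x := by
  rw [Finset.mem_insert, Finset.mem_singleton, not_or] at hx
  exact Equiv.swap_apply_of_ne_of_ne hx.1 hx.2

theorem add_eq_of_mem_pair {G : Type*} [AddCommGroup G] [DecidableEq G] {u v x y : G}
    (hx : x ∈ ({u, v} : Finset G))
    (hy : y ∈ ({u, v} : Finset G)) (hxy : x ≠ y) : x + y = u + v := by
  rw [Finset.mem_insert, Finset.mem_singleton] at hx hy
  rcases hx with rfl | rfl <;> rcases hy with rfl | rfl <;> simp_all [add_comm]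

/-- The pointwise form of the lower bound for a transposition. -/
theorem incidence_le_defect {A B C E F H V : Prop} [Decidable A] [Decidable B] [Decidable C]
    [Decidable E] [Decidable F] [Decidable H] [Decidable V] (hA : A → ¬ B → ¬ C → V)
    (hB : B → ¬ A → ¬ C → V) (hC : C → ¬ A → ¬ B → V) (hE : A → E → B) (hABE : A → ¬ C → E → V)
    (hAC : A → ¬ B → C → F → V) (hBC : B → ¬ A → C → H → V) :
    (((if A then 1 else 0) + (if B then 1 else 0) + (if C then 1 else 0) -
      2 * ((if A ∧ B then 1 else 0) + (if A ∧ C then 1 else 0) + (if B ∧ C then 1 else 0))) +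
      ((if A ∧ E then 1 else 0) + (if A ∧ C ∧ F then 1 else 0) +
        (if B ∧ C ∧ H then 1 else 0)) : ℤ) ≤ if V then 1 else 0 := by
  -- When `A`, `B`, `C` all hold, the incidence part is `3 - 6 = -3`, and the exceptional terms add
  -- at most `3`.
  by_cases A <;> by_cases B <;> by_cases C <;> simp_all only [true_and, false_and,
    and_true, and_false, if_true, if_false, forall_true_left, not_true_eq_false,
    not_false_eq_true, IsEmpty.forall_iff] <;> first | norm_num; done | split_ifs <;> simp_all

/-- The pointwise form of the upper bound for a transposition. -/
theorem defect_le_incidence {A B C E F H V : Prop} [Decidable A] [Decidable B] [Decidable C]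
    [Decidable E] [Decidable F] [Decidable H] [Decidable V] (h0 : ¬ A → ¬ B → ¬ C → ¬ V)
    (hABC : A → B → ¬ C) (hAB : A → B → ¬ E → ¬ V) (hAC : A → C → ¬ F → ¬ V)
    (hBC : B → C → ¬ H → ¬ V) :
    (if V then 1 else 0) ≤
    (((if A then 1 else 0) + (if B then 1 else 0) + (if C then 1 else 0) -
      2 * ((if A ∧ B then 1 else 0) + (if A ∧ C then 1 else 0) + (if B ∧ C then 1 else 0))) +
      ((if A ∧ E then 1 else 0) + (if A ∧ C ∧ F then 1 else 0) +
        (if B ∧ C ∧ H then 1 else 0)) : ℤ) := by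
  by_cases A <;> by_cases B <;> by_cases C <;> simp_all only [true_and, false_and,
    and_true, and_false, if_true, if_false, forall_true_left, not_true_eq_false,
    not_false_eq_true, IsEmpty.forall_iff] <;> first | norm_num; done | split_ifs <;> simp_all

/-! ### Counting failures of additivity from the support -/

section SupportCount

variable {G : Type*} [AddCommGroup G] [Fintype G] [DecidableEq G]

/-- The total number of incidences of `a`, `b`, `a + b` with `D`, minus twice the number of
incidences of their pairs with `D × D`. -/
theorem sum_incidence (D : Finset G) :
    ∑ x : G × G, (((if x.1 ∈ D then 1 else 0) + (if x.2 ∈ D then 1 else 0) +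
        (if x.1 + x.2 ∈ D then 1 else 0)
      - 2 * ((if x.1 ∈ D ∧ x.2 ∈ D then 1 else 0) + (if x.1 ∈ D ∧ x.1 + x.2 ∈ D then 1 else 0) +
        (if x.2 ∈ D ∧ x.1 + x.2 ∈ D then 1 else 0))) : ℤ) =
      3 * D.card * (Fintype.card G - 2 * D.card) := by
  have e1 (a : G) (F : G → ℤ) : ∑ b, F (a + b) = ∑ c, F c :=
    Fintype.sum_equiv (Equiv.addLeft a) _ _ fun _ => rfl
  have e2 (b : G) (F : G → ℤ) : ∑ a, F (a + b) = ∑ c, F c :=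
    Fintype.sum_equiv (Equiv.addRight b) _ _ fun _ => rfl
  have i1 : ∑ a, (if a ∈ D then 1 else 0 : ℤ) = D.card := by simp
  have j1 : ∑ x : G × G, (if x.1 ∈ D then 1 else 0 : ℤ) = D.card * Fintype.card G := by
    rw [Fintype.sum_prod_type_right]; simp [mul_comm]
  have j2 : ∑ x : G × G, (if x.2 ∈ D then 1 else 0 : ℤ) = D.card * Fintype.card G := by
    rw [Fintype.sum_prod_type]; simp [mul_comm]
  have j3 : ∑ x : G × G, (if x.1 + x.2 ∈ D then 1 else 0 : ℤ) = D.card * Fintype.card G := by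
    rw [Fintype.sum_prod_type]
    simp only [e1 _ fun c => if c ∈ D then (1 : ℤ) else 0, i1]
    simp [mul_comm]
  have i2 : ∑ a, (if a ∈ D then (D.card : ℤ) else 0) = D.card * D.card := by simp
  have k1 : ∑ x : G × G, (if x.1 ∈ D ∧ x.2 ∈ D then 1 else 0 : ℤ) = D.card * D.card := by
    rw [Fintype.sum_prod_type, ← i2]
    refine Finset.sum_congr rfl fun a _ => ?_
    by_cases ha : a ∈ D <;> simp [ha]
  have k2 : ∑ x : G × G, (if x.1 ∈ D ∧ x.1 + x.2 ∈ D then 1 else 0 : ℤ) = D.card * D.card := by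
    rw [Fintype.sum_prod_type, ← i2]
    refine Finset.sum_congr rfl fun a _ => ?_
    rw [e1 a fun c => if a ∈ D ∧ c ∈ D then (1 : ℤ) else 0]
    by_cases ha : a ∈ D <;> simp [ha]
  have k3 : ∑ x : G × G, (if x.2 ∈ D ∧ x.1 + x.2 ∈ D then 1 else 0 : ℤ) = D.card * D.card := by
    rw [Fintype.sum_prod_type_right, ← i2]
    refine Finset.sum_congr rfl fun b _ => ?_
    rw [e2 b fun c => if b ∈ D ∧ c ∈ D then (1 : ℤ) else 0]
    by_cases hb : b ∈ D <;> simp [hb]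
  rw [Finset.sum_sub_distrib, ← Finset.mul_sum, Finset.sum_add_distrib, Finset.sum_add_distrib,
    Finset.sum_add_distrib, Finset.sum_add_distrib, j1, j2, j3, k1, k2, k3]
  ring

/-- The pairs from a triple `a`, `b`, `a + b` at which a transposition of two elements `D`
destroys additivity. -/
theorem sum_exceptional_incidence (D : Finset G) :
    ∑ x : G × G, (((if x.1 ∈ D ∧ x.1 = x.2 then 1 else 0) +
        (if x.1 ∈ D ∧ x.1 + x.2 ∈ D ∧ x.1 ≠ x.1 + x.2 then 1 else 0) +
        (if x.2 ∈ D ∧ x.1 + x.2 ∈ D ∧ x.2 ≠ x.1 + x.2 then 1 else 0)) : ℤ) =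
      D.card + 2 * (D.card * (D.card - 1)) := by
  have e1 (a : G) (F : G → ℤ) : ∑ b, F (a + b) = ∑ c, F c :=
    Fintype.sum_equiv (Equiv.addLeft a) _ _ fun _ => rfl
  have e2 (b : G) (F : G → ℤ) : ∑ a, F (a + b) = ∑ c, F c :=
    Fintype.sum_equiv (Equiv.addRight b) _ _ fun _ => rfl
  have i1 : ∀ a ∈ D, ∑ c, (if c ∈ D ∧ a ≠ c then 1 else 0 : ℤ) = D.card - 1 := by
    intro a ha
    rw [Finset.sum_boole]
    have : (Finset.univ.filter fun c => c ∈ D ∧ a ≠ c) = D.erase a := by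
      ext c; simp [and_comm, eq_comm]
    rw [this, Finset.card_erase_of_mem ha, Nat.cast_sub (Finset.card_pos.2 ⟨a, ha⟩)]
    simp
  have i0 : ∑ a, (if a ∈ D then 1 else 0 : ℤ) = D.card := by simp
  have i2 : ∑ a, (if a ∈ D then (D.card - 1 : ℤ) else 0) = D.card * (D.card - 1) := by
    simp [mul_sub]
  have j1 : ∑ x : G × G, (if x.1 ∈ D ∧ x.1 = x.2 then 1 else 0 : ℤ) = D.card := by
    rw [Fintype.sum_prod_type, ← i0]
    refine Finset.sum_congr rfl fun a _ => ?_
    by_cases ha : a ∈ D <;> simp [ha]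
  have j2 : ∑ x : G × G, (if x.1 ∈ D ∧ x.1 + x.2 ∈ D ∧ x.1 ≠ x.1 + x.2 then 1 else 0 : ℤ) =
      D.card * (D.card - 1) := by
    rw [Fintype.sum_prod_type, ← i2]
    refine Finset.sum_congr rfl fun a _ => ?_
    rw [e1 a fun c => if a ∈ D ∧ c ∈ D ∧ a ≠ c then (1 : ℤ) else 0]
    split_ifs with ha
    · simpa only [ha, true_and] using i1 a ha
    · simp [ha]
  have j3 : ∑ x : G × G, (if x.2 ∈ D ∧ x.1 + x.2 ∈ D ∧ x.2 ≠ x.1 + x.2 then 1 else 0 : ℤ) =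
      D.card * (D.card - 1) := by
    rw [Fintype.sum_prod_type_right, ← i2]
    refine Finset.sum_congr rfl fun b _ => ?_
    rw [e2 b fun c => if b ∈ D ∧ c ∈ D ∧ b ≠ c then (1 : ℤ) else 0]
    split_ifs with hb
    · simpa only [hb, true_and] using i1 b hb
    · simp [hb]
  rw [Finset.sum_add_distrib, Finset.sum_add_distrib, j1, j2, j3]
  ring

theorem card_additivityDefect (f : G → G) : ((additivityDefect f).card : ℤ) =
    ∑ x : G × G, if f (x.1 + x.2) ≠ f x.1 + f x.2 then 1 else 0 := by
  rw [additivityDefect, Finset.sum_boole]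

/-- If `k` of `a`, `b`, `a + b` are moved, the summand of `sum_incidence` is `0, 1, 0, -3` for `k =
0, 1, 2, 3`. It is positive only for `k = 1`, where additivity fails. -/
theorem le_card_additivityDefect (f : Equiv.Perm G) :
    (3 * f.support.card * (Fintype.card G - 2 * f.support.card) : ℤ) ≤
      (additivityDefect f).card := by
  rw [← sum_incidence, card_additivityDefect]
  refine Finset.sum_le_sum fun x _ => ?_
  have h1 := @Equiv.Perm.mem_support _ _ _ f x.1
  have h2 := @Equiv.Perm.mem_support _ _ _ f x.2
  have h3 := @Equiv.Perm.mem_support _ _ _ f (x.1 + x.2)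
  by_cases m1 : x.1 ∈ f.support <;> by_cases m2 : x.2 ∈ f.support <;>
    by_cases m3 : x.1 + x.2 ∈ f.support <;>
    by_cases h : f (x.1 + x.2) = f x.1 + f x.2 <;> simp only [m1, m2, m3, h] <;> simp_all

/-- On the pair the swap is `x ↦ u + v - x`. This breaks additivity at `a = b` in the pair, and
where one summand and the sum are its two distinct points, unless the third point also lies in the
pair; the absence of 2-torsion is what forces these failures. -/
theorem le_card_additivityDefect_swap (h2 : ∀ x : G, x + x = 0 → x = 0) {u v : G} (huv : u ≠ v) :
    (6 * Fintype.card G - 18 : ℤ) ≤ (additivityDefect (Equiv.swap u v)).card := by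
  rw [swap_card_identity huv, ← sum_incidence, ← sum_exceptional_incidence,
    ← Finset.sum_add_distrib, card_additivityDefect]
  refine Finset.sum_le_sum fun x _ => ?_
  obtain ⟨a, b⟩ := x
  have hself : ∀ x ∈ ({u, v} : Finset G), x + x ≠ u + v := by
    intro x hx h
    rw [Finset.mem_insert, Finset.mem_singleton] at hx
    rcases hx with rfl | rfl
    · exact huv (add_left_cancel h)
    · exact huv (add_right_cancel h).symm
  have hab (ha : a ∈ ({u, v} : Finset G)) (hc : a + b ∉ ({u, v} : Finset G)) (hab : a = b) :
      Equiv.swap u v (a + b) ≠ Equiv.swap u v a + Equiv.swap u v b := by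
    subst hab
    rw [swap_apply_of_notMem_pair hc, swap_apply_of_mem_pair ha]
    intro h
    refine hself a ha (sub_eq_zero.1 (h2 _ ?_))
    nth_rewrite 1 [h]
    abel
  have hac (x y : G) (hx : x ∈ ({u, v} : Finset G)) (hy : y ∉ ({u, v} : Finset G))
      (hc : x + y ∈ ({u, v} : Finset G)) (hne : x ≠ x + y) :
      Equiv.swap u v (x + y) ≠ Equiv.swap u v x + Equiv.swap u v y := by
    rw [swap_apply_of_notMem_pair hy, swap_apply_of_mem_pair hx, swap_apply_of_mem_pair hc]
    intro h
    have hy0 : y = 0 := h2 y (by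
      have : y + y = u + v - x + y - (u + v - (x + y)) := by abel
      rw [this, h, sub_self])
    exact hne (by simp [hy0])
  have hs (x : G) : x ∈ ({u, v} : Finset G) → Equiv.swap u v x ≠ x := fun hx h => by
    rw [swap_apply_of_mem_pair hx, sub_eq_iff_eq_add] at h
    exact hself x hx h.symm
  refine incidence_le_defect (fun h1 h2 h3 => ?_) (fun h2 h1 h3 => ?_) (fun h3 h1 h2 => ?_)
    (fun h1 h => h ▸ h1) hab (hac a b) (fun h2 h1 h3 => ?_)
  · rw [swap_apply_of_notMem_pair h2, swap_apply_of_notMem_pair h3]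
    exact fun h => hs a h1 (add_right_cancel h).symm
  · rw [swap_apply_of_notMem_pair h1, swap_apply_of_notMem_pair h3]
    exact fun h => hs b h2 (add_left_cancel h).symm
  · rw [swap_apply_of_notMem_pair h1, swap_apply_of_notMem_pair h2]
    exact hs _ h3
  · rw [add_comm a b] at h3 ⊢
    rw [add_comm (Equiv.swap u v a)]
    exact hac b a h2 h1 h3

/-- The hypothesis on sums keeps `0` out of the pair and forbids `a`, `b`, `a + b` all lying in it,
so the pointwise lower bound becomes sharp. -/
theorem card_additivityDefect_swap_le {u v : G} (huv : u ≠ v)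
    (hsum : ∀ x ∈ ({u, v} : Finset G), ∀ y ∈ ({u, v} : Finset G),
      x + y ∉ ({u, v} : Finset G)) :
    ((additivityDefect (Equiv.swap u v)).card : ℤ) ≤ 6 * Fintype.card G - 18 := by
  rw [swap_card_identity huv, ← sum_incidence, ← sum_exceptional_incidence,
    ← Finset.sum_add_distrib, card_additivityDefect]
  refine Finset.sum_le_sum fun x _ => ?_
  obtain ⟨a, b⟩ := x
  have hab (ha : a ∈ ({u, v} : Finset G)) (hb : b ∈ ({u, v} : Finset G)) (hne : a ≠ b) :
      Equiv.swap u v (a + b) = Equiv.swap u v a + Equiv.swap u v b := by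
    rw [swap_apply_of_notMem_pair (hsum a ha b hb), swap_apply_of_mem_pair ha,
      swap_apply_of_mem_pair hb, ← add_eq_of_mem_pair ha hb hne]
    abel
  have hac (x y : G) (hx : x ∈ ({u, v} : Finset G)) (h : x = x + y) :
      Equiv.swap u v (x + y) = Equiv.swap u v x + Equiv.swap u v y := by
    have hy : y = 0 := left_eq_add.1 h
    have h0 : (0 : G) ∉ ({u, v} : Finset G) := fun h0 => hsum x hx 0 h0 (by rwa [add_zero])
    rw [hy, swap_apply_of_notMem_pair h0, add_zero, add_zero]
  refine defect_le_incidence (fun h1 h2 h3 => ?_) (fun h1 h2 => hsum a h1 b h2)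
    (fun h1 h2 h => not_not.2 (hab h1 h2 h)) (fun h1 _ h => not_not.2 (hac a b h1 (not_not.1 h)))
    (fun h2 _ h => ?_)
  · rw [swap_apply_of_notMem_pair h1, swap_apply_of_notMem_pair h2, swap_apply_of_notMem_pair h3]
    exact not_not.2 rfl
  · have := hac b a h2 (by rw [add_comm b a]; exact not_not.1 h)
    rw [add_comm b a, add_comm (Equiv.swap u v b)] at this
    exact not_not.2 this

end SupportCount

/-! ### The lower bound modulo a prime -/

theorem le_card_additivityDefect_zmod {p : ℕ} [Fact p.Prime] (hp : 31 < p)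
    (f : Equiv.Perm (ZMod p)) (hf : ¬ ∀ x y, f (x + y) = f x + f y) :
    6 * p - 18 ≤ (additivityDefect f).card := by
  by_contra! hlt
  -- `9 * (6 * p - 18) ≤ 54 * p < 2 * p ^ 2`, since `p > 27`.
  obtain ⟨g, hg⟩ := exists_addMonoidHom_of_card_additivityDefect_lt f (by
    rw [ZMod.card]; nlinarith [Nat.sub_le (6 * p) 18])
  rw [ZMod.card] at hg
  have hginj : Function.Injective g := by
    rw [injective_iff_map_eq_zero]
    intro a ha
    by_contra ha0
    have hg0 : ∀ x, g x = 0 := fun x => by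
      have hx : x = (x / a).val • a := by
        rw [nsmul_eq_mul, ZMod.natCast_zmod_val, div_mul_cancel₀ _ ha0]
      rw [hx, map_nsmul, ha, smul_zero]
    -- A bijection meets the zero map at one point only, too few for `hg`.
    have hcard : (Finset.univ.filter fun x => f x ≠ g x) = Finset.univ.erase (f.symm 0) := by
      ext x; simp [hg0, Equiv.eq_symm_apply]
    rw [hcard, Finset.card_erase_of_mem (Finset.mem_univ _), Finset.card_univ, ZMod.card] at hg
    omega
  let g' : ZMod p ≃+ ZMod p := AddEquiv.ofBijective g (Finite.injective_iff_bijective.1 hginj)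
  have hg' : ∀ x, g' x = g x := fun _ => rfl
  let e : Equiv.Perm (ZMod p) := f.trans g'.symm.toEquiv
  have he : ∀ x, e x = g'.symm (f x) := fun _ => rfl
  have hdef : additivityDefect e = additivityDefect f := by
    ext x
    simp only [additivityDefect, he, ← map_add, Finset.mem_filter, ne_eq,
      EmbeddingLike.apply_eq_iff_eq]
  have hsupp : e.support = Finset.univ.filter fun x => f x ≠ g x := by
    ext x
    simp [he, AddEquiv.symm_apply_eq, hg']
  rw [← hsupp] at hg
  rw [← hdef] at hlt
  have he1 : e ≠ 1 := by
    intro h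
    apply hf
    have hfg : ∀ x, f x = g x := fun x => by
      rw [← hg', ← AddEquiv.symm_apply_eq, ← he, h, Equiv.Perm.one_apply]
    intro x y
    simp only [hfg, map_add]
  have h18 : ((additivityDefect e).card : ℤ) < 6 * p - 18 := by omega
  rcases (Equiv.Perm.two_le_card_support_of_ne_one he1).eq_or_lt with hm | hm
  · obtain ⟨u, v, huv, hs⟩ := Equiv.Perm.card_support_eq_two.1 hm.symm
    have := le_card_additivityDefect_swap (G := ZMod p) (fun x hx => by
      rw [← two_mul, mul_eq_zero] at hx
      refine hx.resolve_left fun h => ?_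
      have : p ∣ 2 := (ZMod.natCast_eq_zero_iff 2 p).1 (by exact_mod_cast h)
      have := Nat.le_of_dvd (by norm_num) this
      omega) huv
    rw [← hs, ZMod.card] at this
    omega
  -- `3 * m * (p - 2 * m)` is concave in `m`, and large enough at both ends of `3 ≤ m < p / 3`.
  · have := le_card_additivityDefect e
    rw [ZMod.card] at this
    zify at hg hm hp
    nlinarith

/-! ### From group structures to permutations of `ZMod p` -/

theorem exists_equiv_zmod {G : Type*} (A : Group G) (p : ℕ) [Fact p.Prime]
    (hG : Nat.card G = p) : ∃ φ : G ≃ ZMod p, ∀ a b, φ (A.mul a b) = φ a + φ b := by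
  let := A
  have : IsCyclic G := isCyclic_of_prime_card hG
  let e := (zmodCyclicMulEquiv (G := G) inferInstance).symm
  rw [hG] at e
  exact ⟨e.toEquiv.trans Multiplicative.toAdd, fun a b => by
    change Multiplicative.toAdd (e (a * b)) = _
    rw [map_mul]; rfl⟩

theorem groupDist_eq {G : Type*} [Finite G] (A B : Group G) {p : ℕ} [Fact p.Prime]
    (φ ψ : G ≃ ZMod p) (hφ : ∀ a b, φ (A.mul a b) = φ a + φ b)
    (hψ : ∀ a b, ψ (B.mul a b) = ψ a + ψ b) :
    groupDist A B = (additivityDefect (φ.symm.trans ψ)).card := by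
  rw [groupDist, ← Set.ncard_coe_finset]
  refine Set.ncard_congr (fun x _ => (φ x.1, φ x.2)) ?_ ?_ ?_
  · rintro ⟨a, b⟩ h
    simp only [Set.mem_ofPred_eq, additivityDefect, Finset.coe_filter, Finset.mem_univ, true_and,
      ← hφ, Equiv.trans_apply, Equiv.symm_apply_apply, ← hψ] at h ⊢
    exact fun h' => h (ψ.injective h')
  · rintro ⟨a, b⟩ ⟨c, d⟩ _ _ h
    simpa using h
  · rintro ⟨x, y⟩ h
    refine ⟨(φ.symm x, φ.symm y), ?_, by simp⟩
    rw [additivityDefect, Finset.mem_coe, Finset.mem_filter] at h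
    intro h'
    apply h.2
    simp only [Equiv.trans_apply]
    rw [← hψ, ← h', ← φ.apply_symm_apply x, ← φ.apply_symm_apply y, ← hφ]
    simp only [Equiv.symm_apply_apply, Equiv.apply_symm_apply]

theorem mainTheorem2 {G : Type*} [Finite G] (A : Group G) (p : ℕ) (hp : p.Prime) (hp31 : 31 < p)
    (hG : Nat.card G = p) : cayleyStability A = 6 * p - 18 := by
  have : Fact p.Prime := ⟨hp⟩
  obtain ⟨φ, hφ⟩ := exists_equiv_zmod A p hG
  have lower : ∀ B : Group G, B ≠ A → 6 * p - 18 ≤ groupDist A B := by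
    intro B hB
    obtain ⟨ψ, hψ⟩ := exists_equiv_zmod B p hG
    rw [groupDist_eq A B φ ψ hφ hψ]
    refine le_card_additivityDefect_zmod hp31 _ fun h => hB ?_
    refine Group.ext (funext₂ fun a b => ψ.injective ?_)
    have := h (φ a) (φ b)
    simp only [← hφ, Equiv.trans_apply, Equiv.symm_apply_apply, ← hψ] at this
    exact this.symm
  have hsmall : ∀ n : ℕ, n ≠ 0 → n < p → (n : ZMod p) ≠ 0 := fun n h0 hn h =>
    h0 (Nat.eq_zero_of_dvd_of_lt ((ZMod.natCast_eq_zero_iff n p).1 h) hn)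
  have h1 := hsmall 1 (by norm_num) (by omega)
  have h2 := hsmall 2 (by norm_num) (by omega)
  have h3 := hsmall 3 (by norm_num) (by omega)
  push_cast at h1 h2 h3
  have huv : (1 : ZMod p) ≠ -1 := fun h => h2 (by linear_combination h)
  -- The sums are `2`, `0`, `-2`; one of them equals `1` or `-1` only if `1 = 0` or `3 = 0`.
  have upper := card_additivityDefect_swap_le huv (by
    intro x hx y hy h
    simp only [Finset.mem_insert, Finset.mem_singleton] at hx hy h
    rcases hx with rfl | rfl <;> rcases hy with rfl | rfl <;> rcases h with h | h <;> grind)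
  rw [ZMod.card] at upper
  let ψ := φ.trans (Equiv.swap (1 : ZMod p) (-1))
  -- Transporting addition along `ψ` makes the transition map from `A` to `B` exactly the swap.
  let B : Group G := (ψ.trans Multiplicative.ofAdd).group
  have hψ : ∀ a b, ψ (B.mul a b) = ψ a + ψ b := fun a b => ψ.apply_symm_apply _
  have hdist : groupDist A B = (additivityDefect (Equiv.swap (1 : ZMod p) (-1))).card := by
    rw [groupDist_eq A B φ ψ hφ hψ]
    congr 2
    ext x
    simp [ψ]
  have hBA : B ≠ A := by
    intro hBA
    have h0 : (additivityDefect (Equiv.swap (1 : ZMod p) (-1))).card = 0 := by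
      rw [← hdist, hBA]
      simp [groupDist]
    have := le_card_additivityDefect_swap (G := ZMod p) (fun x hx => by
      rw [← two_mul, mul_eq_zero] at hx
      exact hx.resolve_left h2) huv
    rw [h0, ZMod.card] at this
    omega
  have hB : groupDist A B = 6 * p - 18 := le_antisymm (by omega) (lower B hBA)
  refine le_antisymm (Nat.sInf_le ⟨B, hBA, hB⟩) (le_csInf ⟨_, B, hBA, hB⟩ ?_)
  rintro d ⟨C, hC, rfl⟩
  exact lower C hC
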